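/- **Kinematics.** Let $n>3$ and let $k_1,\dots,k_n$ be complex massless momenta in four dimensions, written as bispinors (complex $2\times2$ matrices with $k^2=\det k$ and $2p\cdot q=(p+q)^2-p^2-q^2$), with $k_i^2=0$ and $\sum_i k_i=0$. Assume the kinematics are generic: $s_S:=\big(\sum_{i\in S}k_i\big)^2\neq0$ for all $S\subset\{1,\dots,n\}$ with $2\le|S|\le n-2$. Write $s_{1\dots j}=s_{\{1,\dots,j\}}$. **Numerators.** Fix any reference spinor $|\eta\rangle\in\mathbb{C}^2$ (the choice $|\eta\rangle=|1\rangle$ is allowed). For momenta $K_A,K_B$, possibly off shell, put $X_{A,B}=\langle\eta|K_AK_B|\eta\rangle$; thus $X_{i,j}=\langle\eta i\rangle[ij]\langle j\eta\rangle$ for on-shell momenta. An index such as $A=n+i$ denotes the momentum $K_A=k_n+k_i$. For a permutation $\rho$ of $\{2,\dots,n-1\}$, written $(\rho_1,\dots,\rho_{n-2})$, and $A_\rho=[\rho_1,[\rho_2,[\dots,[\rho_{n-2},n]]]]$, put $$X^{(A_\rho)}=\prod_{i=1}^{n-2}X_{\,n+\rho_{n-2}+\dots+\rho_{i+1},\;\rho_i}.$$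 **Amplitude.** For distinct punctures $\sigma_1,\dots,\sigma_n\in\mathbb{C}$ let $\sigma_{ab}=\sigma_a-\sigma_b$ and $(w_1\dots w_n)=\sigma_{w_1w_2}\sigma_{w_2w_3}\cdots\sigma_{w_nw_1}$, and let $\mathcal{E}_a=\sum_{b\neq a}2k_a\cdot k_b/\sigma_{ab}$. The integral over $\mathfrak{M}_{0,n}$ against the CHY measure, $$\mathcal{X}_n=\int_{\mathfrak{M}_{0,n}}d\mu^{\rm CHY}_n\Big(\sum_{\rho\in S_{n-2}}\frac{X^{(A_\rho)}}{(1\,\rho\,n)}\Big)\frac1{(12\dots n)},$$ is the sum over the solutions of $\mathcal{E}_1=\dots=\mathcal{E}_n=0$ with distinct punctures, up to Möbius transformations, of the integrand times $(\sigma_{12}\sigma_{2n}\sigma_{n1})^2/\det\big(\partial\mathcal{E}_a/\partial\sigma_b\big)_{a,b\neq1,2,n}$; this summand is Möbius invariant. By convention, a solution at which the determinant is zero contributes $0$, and an infinite sum that is not finitely supported is $0$. The same formula defines the three-particle amplitude $\mathcal{X}_3$. **Claim.** 1. The factor $\sum_{\rho}X^{(A_\rho)}/(1\,\rho\,n)$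 is zero at every solution of the scattering equations, and $\mathcal{X}_n=0$. 2. $\mathcal{X}_n$ satisfies a BCFW recursion. Let $q$ be any momentum with $q^2=q\cdot k_1=q\cdot k_n=0$ and $q\cdot(k_1+\dots+k_j)\neq0$ for $2\le j\le n-2$. Put $z_j=-s_{1\dots j}/\big(2q\cdot(k_1+\dots+k_j)\big)$ and $\hat K_j=k_1+\dots+k_j+z_jq$. Then $$\mathcal{X}_n=\sum_{j=2}^{n-2}\frac1{s_{1\dots j}}\;\mathcal{X}_{j+1}\big(k_1+z_jq,\,k_2,\dots,k_j,\,-\hat K_j\big)\;\mathcal{X}_{n-j+1}\big(\hat K_j,\,k_{j+1},\dots,k_{n-1},\,k_n-z_jq\big).$$ -/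

import Mathlib

open scoped BigOperators Matrix

noncomputable section

/-- The antisymmetric spinor metric. -/
def spinorEps : Matrix (Fin 2) (Fin 2) ℂ := !![0, 1; -1, 0]

/-- Four-dimensional complex momenta are `2 × 2` bispinors, `k² = det k`; this is `2 p · q`. -/
def twoDot (p q : Matrix (Fin 2) (Fin 2) ℂ) : ℂ := (p + q).det - p.det - q.det

/-- `X_{A,B} = ⟨η| K_A K_B |η⟩`, which for `K_A = |a⟩[a|` and `K_B = |b⟩[b|` is
`⟨η a⟩ [a b] ⟨b η⟩`. -/
def spinorX (η : Fin 2 → ℂ) (A B : Matrix (Fin 2) (Fin 2) ℂ) : ℂ :=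
  η ⬝ᵥ ((spinorEps * A * spinorEps * Bᵀ * spinorEps) *ᵥ η)

/-- Massless kinematics for `n` particles: null momenta that sum to zero. -/
def IsMasslessKinematics {n : ℕ} (k : Fin n → Matrix (Fin 2) (Fin 2) ℂ) : Prop :=
  (∀ i, (k i).det = 0) ∧ ∑ i, k i = 0

/-- The Mandelstam invariant `s_S = (∑_{i ∈ S} k_i)²`. -/
def mandelstam {n : ℕ} (k : Fin n → Matrix (Fin 2) (Fin 2) ℂ) (S : Finset (Fin n)) : ℂ :=
  (∑ i ∈ S, k i).det

/-- Generic kinematics: no multi-particle channel is on shell. -/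
def IsGenericKinematics {n : ℕ} (k : Fin n → Matrix (Fin 2) (Fin 2) ℂ) : Prop :=
  ∀ S : Finset (Fin n), 2 ≤ S.card → S.card + 2 ≤ n → mandelstam k S ≠ 0

/-- The tree-level scattering function `E_a = ∑_{b ≠ a} 2 k_a · k_b / σ_{ab}`. -/
def scatteringFn {n : ℕ} (k : Fin n → Matrix (Fin 2) (Fin 2) ℂ) (σ : Fin n → ℂ) (a : Fin n) : ℂ :=
  ∑ b ∈ Finset.univ.erase a, twoDot (k a) (k b) / (σ a - σ b)

/-- Configurations of `n` distinct punctures that solve all scattering equations. -/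
def ScatteringSolution {n : ℕ} (k : Fin n → Matrix (Fin 2) (Fin 2) ℂ) : Type :=
  {σ : Fin n → ℂ // Function.Injective σ ∧ ∀ a, scatteringFn k σ a = 0}

/-- Two configurations are the same point of `𝔐_{0,n}` if a Möbius transformation of the
Riemann sphere maps one to the other. -/
def moebiusSetoid {n : ℕ} (k : Fin n → Matrix (Fin 2) (Fin 2) ℂ) :
    Setoid (ScatteringSolution k) where
  r σ τ := ∃ g : GL (Fin 2) ℂ, ∀ i, g • (σ.1 i : OnePoint ℂ) = (τ.1 i : OnePoint ℂ)
  iseqv :=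
    { refl := fun _ => ⟨1, fun _ => one_smul _ _⟩
      symm := fun ⟨g, hg⟩ => ⟨g⁻¹, fun i => by rw [← hg i, inv_smul_smul]⟩
      trans := fun ⟨g, hg⟩ ⟨h, hh⟩ => ⟨h * g, fun i => by rw [mul_smul, hg i, hh i]⟩ }

/-- The solutions of the scattering equations in `𝔐_{0,n}`. -/
abbrev ModuliSolution {n : ℕ} (k : Fin n → Matrix (Fin 2) (Fin 2) ℂ) : Type :=
  Quotient (moebiusSetoid k)

/-- The Jacobian matrix `∂E_a / ∂σ_b` of the scattering functions. -/
def scatteringJacobian {n : ℕ} (k : Fin n → Matrix (Fin 2) (Fin 2) ℂ) (σ : Fin n → ℂ) :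
    Matrix (Fin n) (Fin n) ℂ :=
  Matrix.of fun a b =>
    if a = b then -∑ c ∈ Finset.univ.erase a, twoDot (k a) (k c) / (σ a - σ c) ^ 2
    else twoDot (k a) (k b) / (σ a - σ b) ^ 2

/-- The weight that the delta functions `∏'_a δ(E_a)` give to a solution, for `n = m + 2`
particles: the punctures `1, 2, n` are fixed at the price of `σ₁₂ σ₂ₙ σₙ₁`, the scattering
equations `1, 2, n` are dropped at the price of the same factor, and the other ones contribute
the inverse of their Jacobian determinant. The particles `1, …, n` are the indices
`0, …, m + 1`. -/
def chyWeight {m : ℕ} (k : Fin (m + 2) → Matrix (Fin 2) (Fin 2) ℂ) (σ : Fin (m + 2) → ℂ) : ℂ :=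
  ((σ 0 - σ 1) * (σ 1 - σ (Fin.last (m + 1))) * (σ (Fin.last (m + 1)) - σ 0)) ^ 2 /
    ((scatteringJacobian k σ).submatrix
      (Subtype.val : {a : Fin (m + 2) // a ≠ 0 ∧ a ≠ 1 ∧ a ≠ Fin.last (m + 1)} → Fin (m + 2))
      Subtype.val).det

/-- `∫_{𝔐_{0,n}} dμ^CHY f`, localised on the solutions of the scattering equations. It is used for
Möbius-invariant `dμ^CHY f`, where the choice of representatives does not matter; for the
integrand used here this is `xIntegrand_moebius_invariant` below. -/
def chyIntegral {m : ℕ} (k : Fin (m + 2) → Matrix (Fin 2) (Fin 2) ℂ)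
    (f : (Fin (m + 2) → ℂ) → ℂ) : ℂ :=
  ∑ᶠ q : ModuliSolution k, chyWeight k q.out.1 * f q.out.1

/-- The (inverse) Parke-Taylor factor
`(w₁ w₂ … wₙ) = σ_{w₁ w₂} σ_{w₂ w₃} ⋯ σ_{wₙ w₁}`. -/
def parkeTaylor {m : ℕ} (σ : Fin (m + 2) → ℂ) (w : Fin (m + 2) → Fin (m + 2)) : ℂ :=
  ∏ i, (σ (w i) - σ (w (i + 1)))

/-- The `n - 2 = m` particles other than the first and the last. -/
def middle {m : ℕ} (i : Fin m) : Fin (m + 2) := i.succ.castSucc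

/-- The ordering `1 ρ n`. -/
def halfLadderOrder {m : ℕ} (ρ : Equiv.Perm (Fin m)) : Fin (m + 2) → Fin (m + 2) :=
  Fin.cons 0 (Fin.snoc (fun i => middle (ρ i)) (Fin.last (m + 1)))

/-- `X^{(A_ρ)}` for `A_ρ = [ρ₁, [ρ₂, […, [ρ_{n-2}, n]]]]`: each commutator `[ρ_i, B]` contributes
`X_{B, ρ_i}`, with `B` the sum of the momenta `n, ρ_{n-2}, …, ρ_{i+1}`. -/
def ladderNumerator {m : ℕ} (η : Fin 2 → ℂ) (k : Fin (m + 2) → Matrix (Fin 2) (Fin 2) ℂ)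
    (ρ : Equiv.Perm (Fin m)) : ℂ :=
  ∏ i : Fin m, spinorX η (k (Fin.last (m + 1)) + ∑ l ∈ Finset.Ioi i, k (middle (ρ l)))
    (k (middle (ρ i)))

/-- The half-integrand `∑_ρ X^{(A_ρ)} / (1 ρ n)`. -/
def halfIntegrandX {m : ℕ} (η : Fin 2 → ℂ) (k : Fin (m + 2) → Matrix (Fin 2) (Fin 2) ℂ)
    (σ : Fin (m + 2) → ℂ) : ℂ :=
  ∑ ρ : Equiv.Perm (Fin m), ladderNumerator η k ρ / parkeTaylor σ (halfLadderOrder ρ)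

/-- The `X`-amplitude for `n = m + 2` particles. -/
def xAmplitude {m : ℕ} (η : Fin 2 → ℂ) (k : Fin (m + 2) → Matrix (Fin 2) (Fin 2) ℂ) : ℂ :=
  chyIntegral k fun σ => halfIntegrandX η k σ * (1 / parkeTaylor σ id)

/-- The planar momentum `k_1 + ⋯ + k_j` with `j = p + 1`. -/
def planarMomentum {m : ℕ} (k : Fin (m + 2) → Matrix (Fin 2) (Fin 2) ℂ) (p : ℕ) :
    Matrix (Fin 2) (Fin 2) ℂ :=
  ∑ i ∈ Finset.univ.filter (fun i : Fin (m + 2) => (i : ℕ) ≤ p), k i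

/-- The value `z_j` of the shift parameter, `j = p + 1`, at which
`(k_1 + ⋯ + k_j + z q)² = 0`. -/
def bcfwPole {m : ℕ} (q : Matrix (Fin 2) (Fin 2) ℂ) (k : Fin (m + 2) → Matrix (Fin 2) (Fin 2) ℂ)
    (p : ℕ) : ℂ :=
  -(planarMomentum k p).det / twoDot q (planarMomentum k p)

/-- The intermediate momentum `k_1 + ⋯ + k_j + z_j q`, with `j = p + 1`. -/
def bcfwInternal {m : ℕ} (q : Matrix (Fin 2) (Fin 2) ℂ)
    (k : Fin (m + 2) → Matrix (Fin 2) (Fin 2) ℂ) (p : ℕ) : Matrix (Fin 2) (Fin 2) ℂ :=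
  planarMomentum k p + bcfwPole q k p • q

/-- The `j + 1 = p + 2` momenta `k_1 + z_j q, k_2, …, k_j, -(k_1 + ⋯ + k_j + z_j q)`. -/
def bcfwLeft {m : ℕ} (q : Matrix (Fin 2) (Fin 2) ℂ) (k : Fin (m + 2) → Matrix (Fin 2) (Fin 2) ℂ)
    (p : ℕ) : Fin (p + 2) → Matrix (Fin 2) (Fin 2) ℂ := fun i =>
  if i = 0 then k 0 + bcfwPole q k p • q
  else if i = Fin.last (p + 1) then -bcfwInternal q k p
  else k (Fin.ofNat (m + 2) i)

/-- The `n - j + 1 = (m - p) + 2` momenta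
`k_1 + ⋯ + k_j + z_j q, k_{j+1}, …, k_{n-1}, k_n - z_j q`. -/
def bcfwRight {m : ℕ} (q : Matrix (Fin 2) (Fin 2) ℂ) (k : Fin (m + 2) → Matrix (Fin 2) (Fin 2) ℂ)
    (p : ℕ) : Fin ((m - p) + 2) → Matrix (Fin 2) (Fin 2) ℂ := fun i =>
  if i = 0 then bcfwInternal q k p
  else if i = Fin.last (m - p + 1) then k (Fin.last (m + 1)) - bcfwPole q k p • q
  else k (Fin.ofNat (m + 2) (i + p))

theorem moebius_diff {m : ℕ} {σ τ : Fin (m + 2) → ℂ} {g : GL (Fin 2) ℂ}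
    (h : ∀ i, g • (σ i : OnePoint ℂ) = (τ i : OnePoint ℂ)) :
    ∃ (D c : ℂ) (w : Fin (m + 2) → ℂ), D ≠ 0 ∧ (∀ i, w i ≠ 0) ∧
      (∀ i j, w i - w j = c * (σ i - σ j)) ∧
      ∀ i j, τ i - τ j = D * (σ i - σ j) / (w i * w j) := by
  have hw : ∀ i, g 1 0 * σ i + g 1 1 ≠ 0 := by
    intro i h0
    have := h i
    rw [OnePoint.smul_some_eq_ite, if_pos h0] at this
    exact OnePoint.infty_ne_coe _ this
  have ht : ∀ i, τ i = (g 0 0 * σ i + g 0 1) / (g 1 0 * σ i + g 1 1) := by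
    intro i
    have := h i
    rw [OnePoint.smul_some_eq_ite, if_neg (hw i)] at this
    exact (OnePoint.coe_injective this).symm
  refine ⟨g.1.det, g 1 0, fun i => g 1 0 * σ i + g 1 1, ?_, hw, fun i j => by ring, ?_⟩
  · exact g.det_ne_zero
  · intro i j
    rw [ht i, ht j, Matrix.det_fin_two, div_sub_div _ _ (hw i) (hw j)]
    congr 1
    ring

theorem parkeTaylor_moebius {m : ℕ} {σ τ w : Fin (m + 2) → ℂ} {D : ℂ}
    (h : ∀ i j, τ i - τ j = D * (σ i - σ j) / (w i * w j))
    {o : Fin (m + 2) → Fin (m + 2)} (ho : Function.Bijective o) :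
    parkeTaylor τ o = D ^ (m + 2) / (∏ i, w i) ^ 2 * parkeTaylor σ o := by
  have h1 : ∏ i, w (o i) = ∏ i, w i := ho.prod_comp w
  have h2 : ∏ i, w (o (i + 1)) = ∏ i, w i := by
    rw [← h1]
    exact (Equiv.addRight (1 : Fin (m + 2))).bijective.prod_comp (fun i => w (o i))
  unfold parkeTaylor
  simp only [h, Finset.prod_div_distrib, Finset.prod_mul_distrib, h1, h2]
  simp
  ring

theorem halfLadderOrder_bijective {m : ℕ} (ρ : Equiv.Perm (Fin m)) :
    Function.Bijective (halfLadderOrder ρ) := by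
  refine Finite.injective_iff_bijective.mp ?_
  unfold halfLadderOrder middle
  rw [Fin.cons_injective_iff]
  constructor
  · rintro ⟨i, hi⟩
    induction i using Fin.lastCases with
    | last => simp [Fin.ext_iff] at hi
    | cast i => simp [Fin.ext_iff] at hi
  · rw [Fin.snoc_injective_iff]
    constructor
    · intro i j hij
      simpa using hij
    · rintro ⟨i, hi⟩
      have := (ρ i).2
      simp [Fin.ext_iff] at hi
      omega

theorem twoDot_self {k : Matrix (Fin 2) (Fin 2) ℂ} (h : k.det = 0) : twoDot k k = 0 := by
  rw [Matrix.det_fin_two] at h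
  simp only [twoDot, Matrix.det_fin_two, Matrix.add_apply]
  linear_combination 2 * h

theorem sum_twoDot {n : ℕ} {k : Fin n → Matrix (Fin 2) (Fin 2) ℂ} (hk : IsMasslessKinematics k)
    (a : Fin n) : ∑ b ∈ Finset.univ.erase a, twoDot (k a) (k b) = 0 := by
  rw [Finset.sum_erase (f := fun b => twoDot (k a) (k b)) _ (twoDot_self (hk.1 a))]
  have hb : ∀ b, twoDot (k a) (k b) = k a 0 0 * k b 1 1 + k a 1 1 * k b 0 0
      - k a 0 1 * k b 1 0 - k a 1 0 * k b 0 1 := by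
    intro b
    simp only [twoDot, Matrix.det_fin_two, Matrix.add_apply]
    ring
  have hs : ∀ x y, ∑ b, k b x y = 0 := by
    intro x y
    rw [← Matrix.sum_apply, hk.2]
    rfl
  simp only [hb, Finset.sum_sub_distrib, Finset.sum_add_distrib, ← Finset.mul_sum, hs]
  simp

theorem jacobian_moebius {m : ℕ} {k : Fin (m + 2) → Matrix (Fin 2) (Fin 2) ℂ}
    (hk : IsMasslessKinematics k) (σ : ScatteringSolution k) {τ w : Fin (m + 2) → ℂ} {D c : ℂ}
    (hD : D ≠ 0) (hw : ∀ i, w i ≠ 0) (hc : ∀ i j, w i - w j = c * (σ.1 i - σ.1 j))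
    (h : ∀ i j, τ i - τ j = D * (σ.1 i - σ.1 j) / (w i * w j)) (a b : Fin (m + 2)) :
    scatteringJacobian k τ a b = w a ^ 2 / D * scatteringJacobian k σ.1 a b * (w b ^ 2 / D) := by
  obtain ⟨σ, hinj, hsol⟩ := σ
  simp only at hc h ⊢
  unfold scatteringJacobian
  simp only [Matrix.of_apply]
  split_ifs with hab
  · subst hab
    have hterm : ∀ e ∈ Finset.univ.erase a, twoDot (k a) (k e) / (τ a - τ e) ^ 2 =
        w a ^ 4 / D ^ 2 * (twoDot (k a) (k e) / (σ a - σ e) ^ 2)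
        - 2 * c * w a ^ 3 / D ^ 2 * (twoDot (k a) (k e) / (σ a - σ e))
        + c ^ 2 * w a ^ 2 / D ^ 2 * twoDot (k a) (k e) := by
      intro e he
      have hne : σ a - σ e ≠ 0 :=
        sub_ne_zero.mpr fun hh => (Finset.ne_of_mem_erase he) (hinj hh).symm
      have hwe : w e = w a - c * (σ a - σ e) := by rw [← hc a e]; ring
      have hwa := hw a
      have hwe' := hw e
      have : twoDot (k a) (k e) / (τ a - τ e) ^ 2 =
          twoDot (k a) (k e) * (w a * w e) ^ 2 / (D * (σ a - σ e)) ^ 2 := by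
        rw [h]
        field_simp
      rw [this, hwe]
      field_simp
      ring
    have hE : ∑ e ∈ Finset.univ.erase a, twoDot (k a) (k e) / (σ a - σ e) = 0 := hsol a
    rw [Finset.sum_congr rfl hterm, Finset.sum_add_distrib, Finset.sum_sub_distrib,
      ← Finset.mul_sum, ← Finset.mul_sum, ← Finset.mul_sum, hE, sum_twoDot hk a]
    field_simp
    ring
  · have hne : σ a - σ b ≠ 0 := sub_ne_zero.mpr fun hh => hab (hinj hh)
    have hwa := hw a
    have hwb := hw b
    rw [h]
    field_simp

/-- The summand of the `X`-amplitude does not depend on the representative of a point of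
`𝔐_{0,n}`. -/
theorem xIntegrand_moebius_invariant {m : ℕ} (hm : 1 ≤ m) (η : Fin 2 → ℂ)
    {k : Fin (m + 2) → Matrix (Fin 2) (Fin 2) ℂ} (hk : IsMasslessKinematics k)
    (σ τ : ScatteringSolution k) (hστ : (moebiusSetoid k).r σ τ) :
    chyWeight k τ.1 * (halfIntegrandX η k τ.1 * (1 / parkeTaylor τ.1 id)) =
      chyWeight k σ.1 * (halfIntegrandX η k σ.1 * (1 / parkeTaylor σ.1 id)) := by
  obtain ⟨g, hg⟩ := hστ
  obtain ⟨D, c, w, hD, hw, hc, h⟩ := moebius_diff hg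
  have hP : (∏ i, w i) ≠ 0 := Finset.prod_ne_zero_iff.mpr fun i _ => hw i
  have hhalf : halfIntegrandX η k τ.1 =
      (∏ i, w i) ^ 2 / D ^ (m + 2) * halfIntegrandX η k σ.1 := by
    unfold halfIntegrandX
    rw [Finset.mul_sum]
    refine Finset.sum_congr rfl fun ρ _ => ?_
    rw [parkeTaylor_moebius h (halfLadderOrder_bijective ρ), div_mul_eq_div_div, div_div_eq_mul_div]
    ring
  have hJ : ((scatteringJacobian k τ.1).submatrix
      (Subtype.val : {a : Fin (m + 2) // a ≠ 0 ∧ a ≠ 1 ∧ a ≠ Fin.last (m + 1)} → Fin (m + 2))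
      Subtype.val).det =
      (∏ a : {a : Fin (m + 2) // a ≠ 0 ∧ a ≠ 1 ∧ a ≠ Fin.last (m + 1)}, w a ^ 2 / D) ^ 2 *
      ((scatteringJacobian k σ.1).submatrix
      (Subtype.val : {a : Fin (m + 2) // a ≠ 0 ∧ a ≠ 1 ∧ a ≠ Fin.last (m + 1)} → Fin (m + 2))
      Subtype.val).det := by
    rw [show (scatteringJacobian k τ.1).submatrix
      (Subtype.val : {a : Fin (m + 2) // a ≠ 0 ∧ a ≠ 1 ∧ a ≠ Fin.last (m + 1)} → Fin (m + 2))
      Subtype.val = Matrix.diagonal (fun a => w a.1 ^ 2 / D) *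
        (scatteringJacobian k σ.1).submatrix Subtype.val Subtype.val *
        Matrix.diagonal (fun a => w a.1 ^ 2 / D) from ?_]
    · rw [Matrix.det_mul, Matrix.det_mul, Matrix.det_diagonal]
      ring
    · ext a b
      rw [Matrix.mul_diagonal, Matrix.diagonal_mul]
      exact jacobian_moebius hk σ hD hw hc h a.1 b.1
  have hsplit : ∀ f : Fin (m + 2) → ℂ, ∏ i, f i = f 0 * f 1 * f (Fin.last (m + 1)) *
      ∏ a : {a : Fin (m + 2) // a ≠ 0 ∧ a ≠ 1 ∧ a ≠ Fin.last (m + 1)}, f a := by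
    intro f
    have h01 : (0 : Fin (m + 2)) ≠ 1 := by simp
    have h0l : (0 : Fin (m + 2)) ≠ Fin.last (m + 1) := by simp [Fin.ext_iff]
    have h1l : (1 : Fin (m + 2)) ≠ Fin.last (m + 1) := by
      simp [Fin.ext_iff]
      omega
    rw [← Finset.prod_mul_prod_compl ({0, 1, Fin.last (m + 1)} : Finset (Fin (m + 2)))]
    congr 1
    · rw [Finset.prod_insert (by simp [h0l]), Finset.prod_insert (by simp [h1l]),
        Finset.prod_singleton]
      ring
    · refine Finset.prod_subtype _ (fun x => ?_) f
      simp
  have hfree : (∏ a : {a : Fin (m + 2) // a ≠ 0 ∧ a ≠ 1 ∧ a ≠ Fin.last (m + 1)}, w a ^ 2 / D) =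
      (∏ i, w i) ^ 2 / D ^ (m + 2) *
        (D ^ 3 / (w 0 * w 1 * w (Fin.last (m + 1))) ^ 2) := by
    have h1 := hsplit fun i => w i ^ 2 / D
    have h2 : ∏ i, w i ^ 2 / D = (∏ i, w i) ^ 2 / D ^ (m + 2) := by
      rw [Finset.prod_div_distrib, Finset.prod_pow]
      simp
    rw [h2] at h1
    rw [h1]
    have := hw 0
    have := hw 1
    have := hw (Fin.last (m + 1))
    field_simp
  rw [hhalf, parkeTaylor_moebius h Function.bijective_id]
  unfold chyWeight
  rw [hJ, hfree, h, h, h]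
  have := hw 0
  have := hw 1
  have := hw (Fin.last (m + 1))
  by_cases hd : ((scatteringJacobian k σ.1).submatrix
      (Subtype.val : {a : Fin (m + 2) // a ≠ 0 ∧ a ≠ 1 ∧ a ≠ Fin.last (m + 1)} → Fin (m + 2))
      Subtype.val).det = 0
  · simp [hd]
  by_cases hp : parkeTaylor σ.1 id = 0
  · simp [hp]
  field_simp

end

/-! The sum over half ladders is a determinant in disguise. With x = σ₁, z = σₙ and t the other
punctures, it equals det L(x) / ((x - z) ∏ (x - tₐ)), where L is a weighted Laplacian rooted at z
(`ladderSum_eq_det`). Both sides have the same partial fractions in x. Removing the vertex next to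
particle 1 is a residue of the sum; at x = tₐ column a of L has only its diagonal entry left, so the
determinant drops to the remaining punctures.

On the scattering equations L is singular. Write k_i = |i⟩[i| and u_p = ⟨n p⟩/⟨η p⟩. By the Schouten
identity X_{p,a} (u_a - u_p) = ⟨n η⟩ 2k_a·k_p, so L u is ⟨n η⟩ times the scattering equations with
particle 1 sent to infinity. If a bracket with η vanishes, L is singular for simpler reasons. If u =
0, all products k_a·k_b vanish (`halfIntegrandX_eq_zero_or`): generic kinematics exclude this, and
otherwise the CHY weight is 0 from four particles on.

Hence amplitudes with at least four particles vanish without any genericity, so they also vanish at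
the shifted BCFW momenta. For n ≥ 5 every BCFW term contains such a factor. For n = 4 both factors
have three particles, and one of the two vertices vanishes by three-point kinematics
(`spinorX_bcfw_eq_zero_or`). -/

/-! ### Half-ladder sums as a Laplacian determinant -/

/-- Partial fractions for `P / ((X - z) ∏ₐ (X - tₐ))` when `P` vanishes at `z`. -/
theorem eval_div_eq_sum_of_eval_eq_zero {m : ℕ} {t : Fin (m + 1) → ℂ} (ht : Function.Injective t)
    {z x : ℂ} (hz : ∀ a, t a ≠ z) (hx : ∀ a, x ≠ t a) (hxz : x ≠ z) {P : Polynomial ℂ}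
    (hP : P.natDegree ≤ m + 1) (hPz : P.eval z = 0) :
    P.eval x / ((x - z) * ∏ a, (x - t a)) =
      ∑ a, P.eval (t a) /
        ((x - t a) * ((t a - z) * ∏ b ∈ Finset.univ.erase a, (t a - t b))) := by
  obtain ⟨Q, rfl⟩ := Polynomial.dvd_iff_isRoot.mpr hPz
  have hQ : Q.degree < (Finset.univ : Finset (Fin (m + 1))).card := by
    by_cases h0 : Q = 0
    · simp [h0]
    · rw [Polynomial.natDegree_mul (Polynomial.X_sub_C_ne_zero z) h0,
        Polynomial.natDegree_X_sub_C] at hP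
      rw [Polynomial.degree_eq_natDegree h0, Finset.card_univ, Fintype.card_fin]
      exact_mod_cast (by omega : Q.natDegree < m + 1)
  -- After the root `z` is divided out the degree is at most `m`, so the `m + 1` nodes determine the
  -- quotient.
  have h := congrArg (Polynomial.eval x) (Lagrange.eq_interpolate (v := t) ht.injOn hQ)
  rw [Lagrange.eval_interpolate_not_at_node _ fun i _ => hx i, Lagrange.eval_nodal] at h
  have hprod : ∏ a, (x - t a) ≠ 0 :=
    Finset.prod_ne_zero_iff.mpr fun a _ => sub_ne_zero.mpr (hx a)
  have hxz' := sub_ne_zero.mpr hxz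
  simp only [Polynomial.eval_mul, Polynomial.eval_sub, Polynomial.eval_X, Polynomial.eval_C]
  rw [h, mul_div_mul_left _ _ hxz', mul_div_cancel_left₀ _ hprod]
  refine Finset.sum_congr rfl fun a _ => ?_
  have h1 := sub_ne_zero.mpr (hz a)
  rw [Lagrange.nodalWeight, Finset.prod_inv_distrib]
  field_simp

/-- `(x - s₀) (s₀ - s₁) ⋯ (s_{m-1} - z)`. -/
noncomputable def pathProd {m : ℕ} (x : ℂ) (s : Fin m → ℂ) (z : ℂ) : ℂ :=
  ∏ i : Fin (m + 1), ((Fin.cons x s : Fin (m + 1) → ℂ) i - (Fin.snoc s z : Fin (m + 1) → ℂ) i)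

theorem pathProd_succ {m : ℕ} (x : ℂ) (s : Fin (m + 1) → ℂ) (z : ℂ) :
    pathProd x s z = (x - s 0) * pathProd (s 0) (fun i => s i.succ) z := by
  unfold pathProd
  rw [Fin.prod_univ_succ]
  congr 1
  refine Finset.prod_congr rfl fun i _ => ?_
  congr 1
  · exact congrFun (Fin.cons_self_tail s).symm i
  · induction i using Fin.lastCases with
    | last => rw [Fin.succ_last, Fin.snoc_last, Fin.snoc_last]
    | cast j => rw [Fin.succ_castSucc, Fin.snoc_castSucc, Fin.snoc_castSucc]

/-- The sum over half ladders that end on a root at `z`, with vertices given by `Y` and, at the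
root, by `r`. -/
noncomputable def ladderSum {m : ℕ} (t : Fin m → ℂ) (Y : Fin m → Fin m → ℂ) (r : Fin m → ℂ)
    (z x : ℂ) : ℂ :=
  ∑ ρ : Equiv.Perm (Fin m), (∏ i, (r (ρ i) + ∑ l ∈ Finset.Ioi i, Y (ρ l) (ρ i))) /
    pathProd x (fun i => t (ρ i)) z

/-- Ladders are sorted by the vertex `a` next to `x`: every other particle lies further in and
contributes to its factor, and the rest is a ladder starting at `t a`. The transposition of `0` and
`a` labels the remaining particles by `Fin m`. -/
theorem ladderSum_succ {m : ℕ} (t : Fin (m + 1) → ℂ) (Y : Fin (m + 1) → Fin (m + 1) → ℂ)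
    (r : Fin (m + 1) → ℂ) (z x : ℂ) :
    ladderSum t Y r z x = ∑ a, (r a + ∑ j : Fin m, Y (Equiv.swap 0 a j.succ) a) / (x - t a) *
      ladderSum (fun i => t (Equiv.swap 0 a i.succ))
        (fun i j => Y (Equiv.swap 0 a i.succ) (Equiv.swap 0 a j.succ))
        (fun i => r (Equiv.swap 0 a i.succ)) z (t a) := by
  unfold ladderSum
  rw [← Equiv.Perm.decomposeFin.symm.sum_comp, Fintype.sum_prod_type]
  refine Finset.sum_congr rfl fun a _ => ?_
  rw [Finset.mul_sum]
  refine Finset.sum_congr rfl fun e _ => ?_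
  rw [pathProd_succ, Fin.prod_univ_succ, mul_div_mul_comm]
  simp only [Fin.sum_Ioi_zero, Fin.sum_Ioi_succ, Equiv.Perm.decomposeFin_symm_apply_zero,
    Equiv.Perm.decomposeFin_symm_apply_succ]
  rw [show ∑ j, Y (Equiv.swap 0 a (e j).succ) a = ∑ j : Fin m, Y (Equiv.swap 0 a j.succ) a from
    Equiv.sum_comp e fun j => Y (Equiv.swap 0 a j.succ) a]

/-- The weighted Laplacian, reduced at the root `z`, whose determinant sums the half ladders. -/
noncomputable def ladderMatrix {m : ℕ} (t : Fin m → ℂ) (Y : Fin m → Fin m → ℂ) (r : Fin m → ℂ)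
    (z x : ℂ) : Matrix (Fin m) (Fin m) ℂ := fun a p =>
  if a = p then ∑ c ∈ Finset.univ.erase a, Y c a * (x - t c) / (t a - t c) +
    r a * (x - z) / (t a - z)
  else -(Y p a * (x - t p) / (t a - t p))

/-- The Laplacian form: only differences of `u` enter, except through the root weight. -/
theorem ladderMatrix_mulVec {m : ℕ} (t : Fin m → ℂ) (Y : Fin m → Fin m → ℂ) (r : Fin m → ℂ)
    (z x : ℂ) (u : Fin m → ℂ) (a : Fin m) :
    (ladderMatrix t Y r z x *ᵥ u) a =
      ∑ p ∈ Finset.univ.erase a, Y p a * (x - t p) / (t a - t p) * (u a - u p) +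
        r a * (x - z) / (t a - z) * u a := by
  rw [Matrix.mulVec, dotProduct, ← Finset.add_sum_erase _ _ (Finset.mem_univ a)]
  have h : ∀ p ∈ Finset.univ.erase a, ladderMatrix t Y r z x a p * u p =
      -(Y p a * (x - t p) / (t a - t p)) * u p := fun p hp => by
    rw [ladderMatrix, if_neg (Finset.ne_of_mem_erase hp).symm]
  rw [Finset.sum_congr rfl h, ladderMatrix, if_pos rfl, add_mul, Finset.sum_mul,
    add_right_comm, ← Finset.sum_add_distrib]
  congr 1
  exact Finset.sum_congr rfl fun p _ => by ring

/-- Without the root terms the rows sum to zero, so the constant vector is in the kernel. This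
serves both at `x = z` and for `r = 0`. -/
theorem det_ladderMatrix_eq_zero_of_mul_eq_zero {m : ℕ} (t : Fin (m + 1) → ℂ)
    (Y : Fin (m + 1) → Fin (m + 1) → ℂ) {r : Fin (m + 1) → ℂ} {z x : ℂ}
    (h : ∀ a, r a * (x - z) = 0) : (ladderMatrix t Y r z x).det = 0 := by
  refine Matrix.exists_mulVec_eq_zero_iff.mp ⟨1, one_ne_zero, ?_⟩
  ext a
  rw [ladderMatrix_mulVec, h a]
  simp

/-- Every entry is affine in `x`, so the matrix is a pencil `x A + B`, fixed by its values at `x =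
0` and `x = 1`. -/
theorem exists_polynomial_det_ladderMatrix {m : ℕ} (t : Fin m → ℂ) (Y : Fin m → Fin m → ℂ)
    (r : Fin m → ℂ) (z : ℂ) : ∃ P : Polynomial ℂ, P.natDegree ≤ m ∧
      ∀ x, P.eval x = (ladderMatrix t Y r z x).det := by
  let B := ladderMatrix t Y r z 0
  let A := ladderMatrix t Y r z 1 - B
  refine ⟨((Polynomial.X : Polynomial ℂ) • A.map Polynomial.C + B.map Polynomial.C).det,
    (Polynomial.natDegree_det_X_add_C_le A B).trans_eq (Fintype.card_fin m), fun x => ?_⟩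
  rw [← Polynomial.coe_evalRingHom, RingHom.map_det]
  congr 1
  ext a p
  simp only [A, B, RingHom.mapMatrix_apply, Matrix.map_apply, Matrix.add_apply, Matrix.smul_apply,
    Matrix.sub_apply, smul_eq_mul, Polynomial.coe_evalRingHom, Polynomial.eval_add,
    Polynomial.eval_mul, Polynomial.eval_X, Polynomial.eval_C, ladderMatrix]
  split_ifs
  · rw [add_sub_add_comm, ← Finset.sum_sub_distrib, mul_add, Finset.mul_sum,
      add_add_add_comm, ← Finset.sum_add_distrib]
    congr 1
    · exact Finset.sum_congr rfl fun c _ => by ring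
    · ring
  · ring

/-- At a puncture the row and column of that puncture split off. -/
theorem det_ladderMatrix_zero {m : ℕ} {t : Fin (m + 1) → ℂ} (ht : Function.Injective t)
    (Y : Fin (m + 1) → Fin (m + 1) → ℂ) (r : Fin (m + 1) → ℂ) {z : ℂ} (hz : t 0 ≠ z) :
    (ladderMatrix t Y r z (t 0)).det = (r 0 + ∑ j : Fin m, Y j.succ 0) *
      (ladderMatrix (fun i => t i.succ) (fun i j => Y i.succ j.succ) (fun i => r i.succ) z
        (t 0)).det := by
  have hcol : ∀ i : Fin m, ladderMatrix t Y r z (t 0) i.succ 0 = 0 := fun i => by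
    simp [ladderMatrix]
  have herase : ∀ (a : Fin (m + 1)) (f : Fin (m + 1) → ℂ),
      ∑ c ∈ Finset.univ.erase a, f c = ∑ c, f c - f a := fun a f => by
    rw [← Finset.add_sum_erase _ f (Finset.mem_univ a)]; ring
  have herase' : ∀ (a : Fin m) (f : Fin m → ℂ),
      ∑ c ∈ Finset.univ.erase a, f c = ∑ c, f c - f a := fun a f => by
    rw [← Finset.add_sum_erase _ f (Finset.mem_univ a)]; ring
  rw [Matrix.det_succ_column_zero, Fin.sum_univ_succ]
  simp only [hcol, mul_zero, zero_mul, Finset.sum_const_zero, add_zero, Fin.val_zero, pow_zero,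
    one_mul]
  congr 1
  · rw [ladderMatrix, if_pos rfl, herase, Fin.sum_univ_succ, add_sub_cancel_left,
      mul_div_cancel_right₀ _ (sub_ne_zero.mpr hz), add_comm]
    congr 1
    refine Finset.sum_congr rfl fun j _ => mul_div_cancel_right₀ _ (sub_ne_zero.mpr fun h => ?_)
    exact Fin.succ_ne_zero j (ht h).symm
  · congr 1
    ext a p
    simp only [Matrix.submatrix_apply, Fin.succAbove_zero, ladderMatrix, Fin.succ_inj]
    split_ifs
    · rw [herase, herase', Fin.sum_univ_succ]
      simp
    · rfl

theorem ladderMatrix_reindex {m : ℕ} (e : Equiv.Perm (Fin m)) (t : Fin m → ℂ)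
    (Y : Fin m → Fin m → ℂ) (r : Fin m → ℂ) (z x : ℂ) :
    ladderMatrix (fun i => t (e i)) (fun i j => Y (e i) (e j)) (fun i => r (e i)) z x =
      (ladderMatrix t Y r z x).submatrix e e := by
  ext a p
  simp only [Matrix.submatrix_apply, ladderMatrix, EmbeddingLike.apply_eq_iff_eq]
  split_ifs
  · congr 1
    exact Finset.sum_equiv e (by simp) fun _ _ => rfl
  · rfl

/-- Induction on the number of vertices: the partial fraction expansion of the right side satisfies
the recursion `ladderSum_succ`, since the determinant at each node factors into a vertex times a
smaller determinant. -/
theorem ladderSum_eq_det {m : ℕ} {t : Fin m → ℂ} (ht : Function.Injective t)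
    (Y : Fin m → Fin m → ℂ) (r : Fin m → ℂ) {z x : ℂ} (hz : ∀ a, t a ≠ z) (hx : ∀ a, x ≠ t a)
    (hxz : x ≠ z) :
    ladderSum t Y r z x = (ladderMatrix t Y r z x).det / ((x - z) * ∏ a, (x - t a)) := by
  induction m generalizing x with
  | zero => simp [ladderSum, pathProd, Fin.snoc]
  | succ m ih =>
    obtain ⟨P, hP, hPe⟩ := exists_polynomial_det_ladderMatrix t Y r z
    have hPz : P.eval z = 0 := by
      rw [hPe]
      exact det_ladderMatrix_eq_zero_of_mul_eq_zero t Y fun a => by simp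
    rw [← hPe, eval_div_eq_sum_of_eval_eq_zero ht hz hx hxz hP hPz, ladderSum_succ]
    refine Finset.sum_congr rfl fun a _ => ?_
    have hinj : Function.Injective fun i => t (Equiv.swap 0 a i) := ht.comp (Equiv.injective _)
    have hne : ∀ i : Fin m, Equiv.swap 0 a i.succ ≠ a := fun i h => by
      rw [Equiv.swap_apply_eq_iff, Equiv.swap_apply_right] at h
      exact Fin.succ_ne_zero i h
    rw [ih (t := fun i => t (Equiv.swap 0 a i.succ)) (hinj.comp (Fin.succ_injective m)) _ _ (fun i => hz _)
      (fun i h => hne i (ht h).symm) (hz a)]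
    -- The splitting at puncture `0` is carried to puncture `a` by the transposition, which leaves
    -- the determinant unchanged.
    have hdet := det_ladderMatrix_zero hinj
      (fun i j => Y (Equiv.swap 0 a i) (Equiv.swap 0 a j)) (fun i => r (Equiv.swap 0 a i))
      (z := z) (hz _)
    rw [ladderMatrix_reindex, Matrix.det_submatrix_equiv_self] at hdet
    simp only [Equiv.swap_apply_left] at hdet
    have hprod : ∏ b ∈ Finset.univ.erase a, (t a - t b) =
        ∏ i : Fin m, (t a - t (Equiv.swap 0 a i.succ)) := by
      have h1 : (Finset.univ.erase a : Finset (Fin (m + 1))) =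
          Finset.univ.map ((Fin.succEmb m).trans (Equiv.swap 0 a).toEmbedding) := by
        symm
        refine Finset.eq_of_subset_of_card_le (fun b hb => ?_) (by simp)
        obtain ⟨i, -, rfl⟩ := Finset.mem_map.mp hb
        exact Finset.mem_erase.mpr ⟨hne i, Finset.mem_univ _⟩
      rw [h1, Finset.prod_map]
      rfl
    rw [hPe, hdet, hprod, div_mul_div_comm]

/-! ### Spinor algebra -/

/-- The antisymmetric spinor bracket. -/
def spinorBracket (u v : Fin 2 → ℂ) : ℂ := u 0 * v 1 - u 1 * v 0

theorem exists_eq_vecMulVec_of_det_eq_zero {A : Matrix (Fin 2) (Fin 2) ℂ} (h : A.det = 0) :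
    ∃ u v : Fin 2 → ℂ, A = Matrix.vecMulVec u v := by
  rw [Matrix.det_fin_two] at h
  by_cases h0 : A 0 0 = 0
  · by_cases h1 : A 0 1 = 0
    · refine ⟨![0, 1], A 1, ?_⟩
      ext i j
      fin_cases i <;> fin_cases j <;> simp [Matrix.vecMulVec_apply, h0, h1]
    · refine ⟨![A 0 1, A 1 1], ![0, 1], ?_⟩
      have h2 : A 1 0 = 0 := by
        rw [h0, zero_mul, zero_sub, neg_eq_zero] at h
        exact (mul_eq_zero.mp h).resolve_left h1
      ext i j
      fin_cases i <;> fin_cases j <;> simp [Matrix.vecMulVec_apply, h0, h2]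
  · refine ⟨![1, A 1 0 / A 0 0], A 0, ?_⟩
    ext i j
    fin_cases i <;> fin_cases j <;> simp [Matrix.vecMulVec_apply] <;> field_simp
    linear_combination h

theorem twoDot_eq (p q : Matrix (Fin 2) (Fin 2) ℂ) :
    twoDot p q = p 0 0 * q 1 1 + p 1 1 * q 0 0 - p 0 1 * q 1 0 - p 1 0 * q 0 1 := by
  simp only [twoDot, Matrix.det_fin_two, Matrix.add_apply]
  ring

theorem twoDot_comm (p q : Matrix (Fin 2) (Fin 2) ℂ) : twoDot p q = twoDot q p := by
  rw [twoDot_eq, twoDot_eq]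
  ring

theorem twoDot_vecMulVec (a a' b b' : Fin 2 → ℂ) :
    twoDot (Matrix.vecMulVec a a') (Matrix.vecMulVec b b') =
      spinorBracket a b * spinorBracket a' b' := by
  simp only [twoDot_eq, Matrix.vecMulVec_apply, spinorBracket]
  ring

theorem det_add_smul (P q : Matrix (Fin 2) (Fin 2) ℂ) (z : ℂ) :
    (P + z • q).det = P.det + z * twoDot q P + z ^ 2 * q.det := by
  simp only [twoDot_eq, Matrix.det_fin_two, Matrix.add_apply, Matrix.smul_apply, smul_eq_mul]
  ring

theorem spinorX_eq (η : Fin 2 → ℂ) (A B : Matrix (Fin 2) (Fin 2) ℂ) :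
    spinorX η A B = (η 0 * A 1 1 - η 1 * A 0 1) * (η 0 * B 1 0 - η 1 * B 0 0) -
      (η 0 * A 1 0 - η 1 * A 0 0) * (η 0 * B 1 1 - η 1 * B 0 1) := by
  simp only [spinorX, dotProduct, Matrix.mulVec, Matrix.mul_apply, Fin.sum_univ_two,
    Matrix.transpose_apply]
  simp [spinorEps]
  ring

theorem spinorX_vecMulVec (η a a' b b' : Fin 2 → ℂ) :
    spinorX η (Matrix.vecMulVec a a') (Matrix.vecMulVec b b') =
      spinorBracket η a * spinorBracket a' b' * spinorBracket b η := by
  simp only [spinorX_eq, Matrix.vecMulVec_apply, spinorBracket]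
  ring

theorem spinorX_add_left (η : Fin 2 → ℂ) (A A' B : Matrix (Fin 2) (Fin 2) ℂ) :
    spinorX η (A + A') B = spinorX η A B + spinorX η A' B := by
  simp only [spinorX_eq, Matrix.add_apply]
  ring

theorem spinorX_sum_left {ι : Type*} (η : Fin 2 → ℂ) (s : Finset ι)
    (A : ι → Matrix (Fin 2) (Fin 2) ℂ) (B : Matrix (Fin 2) (Fin 2) ℂ) :
    spinorX η (∑ i ∈ s, A i) B = ∑ i ∈ s, spinorX η (A i) B := by
  classical
  induction s using Finset.induction_on with
  | empty => simp [spinorX_eq]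
  | insert a s ha ih => rw [Finset.sum_insert ha, Finset.sum_insert ha, spinorX_add_left, ih]

/-! ### The half-integrand on the scattering equations -/

theorem parkeTaylor_halfLadderOrder {m : ℕ} (σ : Fin (m + 2) → ℂ) (ρ : Equiv.Perm (Fin m)) :
    parkeTaylor σ (halfLadderOrder ρ) =
      pathProd (σ 0) (fun i => σ (middle (ρ i))) (σ (Fin.last (m + 1))) *
        (σ (Fin.last (m + 1)) - σ 0) := by
  unfold parkeTaylor pathProd
  rw [Fin.prod_univ_castSucc]
  congr 1
  · refine Finset.prod_congr rfl fun i _ => ?_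
    rw [Fin.coeSucc_eq_succ]
    congr 1
    · induction i using Fin.cases with
      | zero => simp [halfLadderOrder]
      | succ j => simp [halfLadderOrder]
    · induction i using Fin.lastCases with
      | last => simp only [halfLadderOrder, Fin.cons_succ, Fin.snoc_last]
      | cast j => simp only [halfLadderOrder, Fin.cons_succ, Fin.snoc_castSucc]
  · rw [Fin.last_add_one]
    simp only [halfLadderOrder, Fin.cons_zero, ← Fin.succ_last, Fin.cons_succ, Fin.snoc_last]

theorem halfIntegrandX_eq_ladderSum {m : ℕ} (η : Fin 2 → ℂ)
    (k : Fin (m + 2) → Matrix (Fin 2) (Fin 2) ℂ) (σ : Fin (m + 2) → ℂ) :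
    halfIntegrandX η k σ = ladderSum (fun i => σ (middle i))
      (fun i j => spinorX η (k (middle i)) (k (middle j)))
      (fun i => spinorX η (k (Fin.last (m + 1))) (k (middle i))) (σ (Fin.last (m + 1))) (σ 0) /
        (σ (Fin.last (m + 1)) - σ 0) := by
  unfold halfIntegrandX ladderSum ladderNumerator
  rw [Finset.sum_div]
  refine Finset.sum_congr rfl fun ρ _ => ?_
  simp only [parkeTaylor_halfLadderOrder, spinorX_add_left, spinorX_sum_left, div_div]

theorem middle_injective {m : ℕ} : Function.Injective (middle : Fin m → Fin (m + 2)) :=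
  (Fin.castSucc_injective _).comp (Fin.succ_injective _)

theorem middle_ne_last {m : ℕ} (a : Fin m) : middle a ≠ Fin.last (m + 1) :=
  (Fin.castSucc_lt_last _).ne

theorem middle_ne_zero {m : ℕ} (a : Fin m) : middle a ≠ 0 := by
  simp [middle, Fin.ext_iff]

theorem sum_univ_middle {m : ℕ} {M : Type*} [AddCommMonoid M] (f : Fin (m + 2) → M) :
    ∑ i, f i = f 0 + (∑ i : Fin m, f (middle i) + f (Fin.last (m + 1))) := by
  rw [Fin.sum_univ_castSucc, Fin.sum_univ_succ, add_assoc]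
  rfl

/-- The scattering equation of a middle particle, with particle `1` sent to infinity. -/
theorem sum_twoDot_crossRatio {m : ℕ} {k : Fin (m + 2) → Matrix (Fin 2) (Fin 2) ℂ}
    (hk : IsMasslessKinematics k) (σ : ScatteringSolution k) (a : Fin m) :
    ∑ p ∈ Finset.univ.erase a, twoDot (k (middle a)) (k (middle p)) *
        (σ.1 0 - σ.1 (middle p)) / (σ.1 (middle a) - σ.1 (middle p)) +
      twoDot (k (middle a)) (k (Fin.last (m + 1))) * (σ.1 0 - σ.1 (Fin.last (m + 1))) /
        (σ.1 (middle a) - σ.1 (Fin.last (m + 1))) = 0 := by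
  obtain ⟨σ, hinj, hsol⟩ := σ
  simp only
  have h : ∑ b ∈ Finset.univ.erase (middle a), twoDot (k (middle a)) (k b) *
      (σ 0 - σ b) / (σ (middle a) - σ b) = 0 := by
    -- (σ₁ - σ_b)/(σ_a - σ_b) = 1 + (σ₁ - σ_a)/(σ_a - σ_b): momentum conservation kills the first
    -- part, the scattering equation the second.
    have hterm : ∀ b ∈ Finset.univ.erase (middle a), twoDot (k (middle a)) (k b) *
        (σ 0 - σ b) / (σ (middle a) - σ b) = (σ 0 - σ (middle a)) *
          (twoDot (k (middle a)) (k b) / (σ (middle a) - σ b)) + twoDot (k (middle a)) (k b) := by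
      intro b hb
      have : σ (middle a) - σ b ≠ 0 :=
        sub_ne_zero.mpr fun hh => Finset.ne_of_mem_erase hb (hinj hh).symm
      field_simp
      ring
    have hE : ∑ b ∈ Finset.univ.erase (middle a),
        twoDot (k (middle a)) (k b) / (σ (middle a) - σ b) = 0 := hsol (middle a)
    rw [Finset.sum_congr rfl hterm, Finset.sum_add_distrib, ← Finset.mul_sum, hE, sum_twoDot hk]
    simp
  -- The erased term can be restored because division by zero gives `0`; the term of particle 1 has
  -- numerator zero.
  rw [Finset.sum_erase _ (by simp), sum_univ_middle] at h
  rw [Finset.sum_erase _ (by simp)]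
  simpa using h

/-- The second alternative is the only way the kernel vector ⟨n p⟩/⟨η p⟩ can degenerate. It is kept
because the BCFW factors need not have generic kinematics. -/
theorem halfIntegrandX_eq_zero_or {m : ℕ} (η : Fin 2 → ℂ)
    {k : Fin (m + 1 + 2) → Matrix (Fin 2) (Fin 2) ℂ} (hk : IsMasslessKinematics k)
    (σ : ScatteringSolution k) :
    halfIntegrandX η k σ.1 = 0 ∨ ∀ a b, twoDot (k a) (k b) = 0 := by
  have hinj := σ.2.1
  rw [or_iff_not_imp_right]
  intro hs
  rw [halfIntegrandX_eq_ladderSum, ladderSum_eq_det (t := fun i => σ.1 (middle i)) (hinj.comp middle_injective) _ _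
    (fun a h => middle_ne_last a (hinj h)) (fun a h => middle_ne_zero a (hinj h).symm)
    (fun h => by simpa [Fin.ext_iff] using hinj h)]
  suffices h : (ladderMatrix (fun i => σ.1 (middle i))
      (fun i j => spinorX η (k (middle i)) (k (middle j)))
      (fun i => spinorX η (k (Fin.last _)) (k (middle i))) (σ.1 (Fin.last _)) (σ.1 0)).det = 0 by
    rw [h]; simp
  choose l l' hl using fun i => exists_eq_vecMulVec_of_det_eq_zero (hk.1 i)
  have hX : ∀ i j, spinorX η (k i) (k j) =
      spinorBracket η (l i) * spinorBracket (l' i) (l' j) * spinorBracket (l j) η := fun i j => by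
    rw [hl i, hl j, spinorX_vecMulVec]
  have hD : ∀ i j, twoDot (k i) (k j) =
      spinorBracket (l i) (l j) * spinorBracket (l' i) (l' j) := fun i j => by
    rw [hl i, hl j, twoDot_vecMulVec]
  by_cases hlast : spinorBracket η (l (Fin.last _)) = 0
  · exact det_ladderMatrix_eq_zero_of_mul_eq_zero _ _ fun a => by simp [hX, hlast]
  by_cases hmid : ∃ a : Fin (m + 1), spinorBracket η (l (middle a)) = 0
  · obtain ⟨a, ha⟩ := hmid
    -- All entries of row `a` carry the factor ⟨a η⟩.
    refine Matrix.det_eq_zero_of_row_eq_zero a fun p => ?_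
    have ha' : spinorBracket (l (middle a)) η = 0 := by
      rw [← neg_eq_zero, ← ha]
      simp only [spinorBracket]
      ring
    simp [ladderMatrix, hX, ha']
  push Not at hmid
  refine Matrix.exists_mulVec_eq_zero_iff.mp ⟨fun p =>
    spinorBracket (l (Fin.last _)) (l (middle p)) / spinorBracket η (l (middle p)), ?_, ?_⟩
  · intro h0
    apply hs
    have hn : ∀ p : Fin (m + 1), spinorBracket (l (Fin.last _)) (l (middle p)) = 0 := fun p =>
      (div_eq_zero_iff.mp (congrFun h0 p)).resolve_right (hmid p)
    have hn' : ∀ b, b ≠ 0 → spinorBracket (l (Fin.last _)) (l b) = 0 := by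
      intro b hb
      induction b using Fin.lastCases with
      | last => simp only [spinorBracket]; ring
      | cast b =>
        obtain ⟨c, rfl⟩ := Fin.exists_succ_eq.mpr (fun h => hb (by rw [h]; rfl) : b ≠ 0)
        exact hn c
    -- Since ⟨η n⟩ ≠ 0, the spinor of `n` is nonzero; all spinors except that of particle 1 are
    -- parallel to it. Momentum conservation then handles particle 1.
    have hne : ∀ a b, a ≠ 0 → b ≠ 0 → twoDot (k a) (k b) = 0 := by
      intro a b ha hb
      have h1 := hn' a ha
      have h2 := hn' b hb
      have h3 : spinorBracket η (l (Fin.last _)) * spinorBracket (l a) (l b) = 0 := by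
        simp only [spinorBracket] at h1 h2 ⊢
        linear_combination (η 0 * l a 1 - η 1 * l a 0) * h2 - (η 0 * l b 1 - η 1 * l b 0) * h1
      rw [hD, (mul_eq_zero.mp h3).resolve_left hlast, zero_mul]
    have hne0 : ∀ a, twoDot (k a) (k 0) = 0 := by
      intro a
      by_cases ha : a = 0
      · rw [ha, twoDot_self (hk.1 0)]
      · have := sum_twoDot hk a
        rwa [Finset.sum_eq_single_of_mem 0 (Finset.mem_erase.mpr ⟨Ne.symm ha, Finset.mem_univ _⟩)
          fun b _ hb => hne a b ha hb] at this
    intro a b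
    by_cases hb : b = 0
    · rw [hb, hne0]
    by_cases ha : a = 0
    · rw [ha, twoDot_comm, hne0]
    exact hne a b ha hb
  · ext a
    rw [ladderMatrix_mulVec, Pi.zero_apply]
    refine Eq.trans ?_ (mul_eq_zero_of_right (spinorBracket (l (Fin.last _)) η)
      (sum_twoDot_crossRatio hk σ a))
    rw [mul_add, Finset.mul_sum]
    have ha := hmid a
    congr 1
    · refine Finset.sum_congr rfl fun p _ => ?_
      have hp := hmid p
      -- The Schouten identity; the vertex at the root is the case where `u` vanishes at `n`.
      have h : spinorX η (k (middle p)) (k (middle a)) *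
          (spinorBracket (l (Fin.last _)) (l (middle a)) / spinorBracket η (l (middle a)) -
            spinorBracket (l (Fin.last _)) (l (middle p)) / spinorBracket η (l (middle p))) =
          spinorBracket (l (Fin.last _)) η * twoDot (k (middle a)) (k (middle p)) := by
        rw [hX, hD]
        field_simp
        simp only [spinorBracket]
        ring
      linear_combination (σ.1 0 - σ.1 (middle p)) / (σ.1 (middle a) - σ.1 (middle p)) * h
    · have h : spinorX η (k (Fin.last _)) (k (middle a)) *
          (spinorBracket (l (Fin.last _)) (l (middle a)) / spinorBracket η (l (middle a))) =
          spinorBracket (l (Fin.last _)) η * twoDot (k (middle a)) (k (Fin.last _)) := by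
        rw [hX, hD]
        field_simp
        simp only [spinorBracket]
        ring
      linear_combination (σ.1 0 - σ.1 (Fin.last _)) / (σ.1 (middle a) - σ.1 (Fin.last _)) * h

/-! ### Vanishing amplitudes -/

theorem chyWeight_eq_zero {m : ℕ} (hm : 2 ≤ m) {k : Fin (m + 2) → Matrix (Fin 2) (Fin 2) ℂ}
    (h : ∀ a b, twoDot (k a) (k b) = 0) (σ : Fin (m + 2) → ℂ) : chyWeight k σ = 0 := by
  have hJ : scatteringJacobian k σ = 0 := by
    ext a b
    simp [scatteringJacobian, h]
  -- From four particles on, index `2` survives the deletion of `0`, `1` and the last, so the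
  -- reduced Jacobian has a zero row.
  rw [chyWeight, hJ, Matrix.det_eq_zero_of_row_eq_zero ⟨⟨2, by omega⟩, by simp [Fin.ext_iff],
    by simp [Fin.ext_iff], by simp [Fin.ext_iff]; omega⟩ fun _ => rfl, div_zero]

theorem xAmplitude_eq_zero_of_forall {m : ℕ} {η : Fin 2 → ℂ}
    {k : Fin (m + 2) → Matrix (Fin 2) (Fin 2) ℂ}
    (h : ∀ σ : ScatteringSolution k, chyWeight k σ.1 = 0 ∨ halfIntegrandX η k σ.1 = 0) :
    xAmplitude η k = 0 :=
  finsum_eq_zero_of_forall_eq_zero fun q => by rcases h q.out with h | h <;> simp [h]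

/-- For at least four particles the amplitude vanishes, generic kinematics or not. -/
theorem xAmplitude_eq_zero {m : ℕ} (hm : 2 ≤ m) (η : Fin 2 → ℂ)
    {k : Fin (m + 2) → Matrix (Fin 2) (Fin 2) ℂ} (hk : IsMasslessKinematics k) :
    xAmplitude η k = 0 := by
  obtain ⟨m, rfl⟩ := Nat.exists_eq_succ_of_ne_zero (by omega : m ≠ 0)
  exact xAmplitude_eq_zero_of_forall fun σ =>
    (halfIntegrandX_eq_zero_or η hk σ).symm.imp_left fun h => chyWeight_eq_zero hm h _

/-- A single ladder remains, with one vertex. The equation `m = 1` is a hypothesis so that the lemma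
also fits the size `m - p` of `bcfwRight`. -/
theorem xAmplitude_three_eq_zero {m : ℕ} (hm : m = 1) {η : Fin 2 → ℂ}
    {k : Fin (m + 2) → Matrix (Fin 2) (Fin 2) ℂ}
    (h : spinorX η (k (Fin.last (m + 1))) (k 1) = 0) : xAmplitude η k = 0 := by
  subst hm
  refine xAmplitude_eq_zero_of_forall fun σ => Or.inr (Finset.sum_eq_zero fun ρ _ => ?_)
  have h1 : (middle (ρ 0) : Fin 3) = 1 := by
    rw [Subsingleton.elim (ρ 0) 0]
    rfl
  have h2 : Finset.Ioi (0 : Fin 1) = ∅ := rfl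
  rw [ladderNumerator, Fin.prod_univ_one, h1, h2, Finset.sum_empty, add_zero, h, zero_div]

/-! ### BCFW factors -/

theorem spinorX_neg_add_self (η : Fin 2 → ℂ) (P R : Matrix (Fin 2) (Fin 2) ℂ) :
    spinorX η (-(P + R)) R = -spinorX η P R := by
  simp only [spinorX_eq, Matrix.neg_apply, Matrix.add_apply]
  ring

/-- The three-point vertex with collinear square brackets vanishes. -/
theorem spinorX_shift_eq_zero (η : Fin 2 → ℂ) {a a' x x' : Fin 2 → ℂ}
    {R : Matrix (Fin 2) (Fin 2) ℂ} {w : ℂ} (hR : R.det = 0) (hxa : spinorBracket x a = 0)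
    (hPR : (Matrix.vecMulVec a a' + R).det ≠ 0)
    (hw : (Matrix.vecMulVec a a' + R + w • Matrix.vecMulVec x x').det = 0) :
    spinorX η (Matrix.vecMulVec a a' + w • Matrix.vecMulVec x x') R = 0 := by
  obtain ⟨b, b', rfl⟩ := exists_eq_vecMulVec_of_det_eq_zero hR
  -- As x ∥ a, the shift alters only the square spinor of `a`. The shifted channel is null and ⟨a b⟩
  -- ≠ 0, so the shifted square bracket vanishes, and the vertex contains it; ⟨a b⟩ is kept as a
  -- multiplier to avoid dividing.
  have hab : spinorBracket a b ≠ 0 := by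
    intro h
    apply hPR
    have : (Matrix.vecMulVec a a' + Matrix.vecMulVec b b').det =
        spinorBracket a b * spinorBracket a' b' := by
      simp only [Matrix.det_fin_two, Matrix.add_apply, Matrix.vecMulVec_apply, spinorBracket]
      ring
    rw [this, h, zero_mul]
  have hw' : spinorBracket a b * spinorBracket a' b' +
      w * (spinorBracket x b * spinorBracket x' b') = 0 := by
    rw [← hw]
    simp only [spinorBracket] at hxa
    simp only [Matrix.det_fin_two, Matrix.add_apply, Matrix.smul_apply, smul_eq_mul,
      Matrix.vecMulVec_apply, spinorBracket]
    linear_combination -(w * (x' 0 * a' 1 - x' 1 * a' 0)) * hxa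
  have hschouten : spinorBracket η x * spinorBracket a b =
      spinorBracket η a * spinorBracket x b := by
    simp only [spinorBracket] at hxa ⊢
    linear_combination -(η 0 * b 1 - η 1 * b 0) * hxa
  have hX : spinorX η (Matrix.vecMulVec a a' + w • Matrix.vecMulVec x x')
      (Matrix.vecMulVec b b') = (spinorBracket η a * spinorBracket a' b' +
        w * (spinorBracket η x * spinorBracket x' b')) * spinorBracket b η := by
    simp only [spinorX_eq, Matrix.add_apply, Matrix.smul_apply, smul_eq_mul,
      Matrix.vecMulVec_apply, spinorBracket]
    ring
  refine (mul_eq_zero.mp ?_).resolve_left hab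
  rw [hX]
  linear_combination spinorBracket b η * spinorBracket η a * hw' +
    spinorBracket b η * w * spinorBracket x' b' * hschouten

theorem planarMomentum_eq_sum_range {m : ℕ} (k : Fin (m + 2) → Matrix (Fin 2) (Fin 2) ℂ) {p : ℕ}
    (hp : p < m + 2) :
    planarMomentum k p = ∑ j ∈ Finset.range (p + 1), k (Fin.ofNat (m + 2) j) := by
  have h : ∀ i : Fin (m + 2), k i = k (Fin.ofNat (m + 2) i) := fun i => by
    congr 1
    ext
    simp
  rw [planarMomentum, Finset.sum_filter, Finset.sum_congr rfl fun i _ => by rw [h i],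
    Fin.sum_univ_eq_sum_range fun j => if j ≤ p then k (Fin.ofNat (m + 2) j) else 0,
    ← Finset.sum_filter]
  congr 1
  ext j
  simp
  omega

theorem planarMomentum_last {m : ℕ} (k : Fin (m + 2) → Matrix (Fin 2) (Fin 2) ℂ) :
    planarMomentum k (m + 1) = ∑ i, k i := by
  rw [planarMomentum, Finset.filter_true_of_mem fun i _ => by omega]

theorem det_bcfwInternal {m : ℕ} {q : Matrix (Fin 2) (Fin 2) ℂ}
    {k : Fin (m + 2) → Matrix (Fin 2) (Fin 2) ℂ} {p : ℕ} (hq : q.det = 0)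
    (hqp : twoDot q (planarMomentum k p) ≠ 0) : (bcfwInternal q k p).det = 0 := by
  rw [bcfwInternal, det_add_smul, hq, bcfwPole]
  field_simp
  ring

theorem sum_univ_middle_eq_of_ite {m : ℕ} (f : ℕ → Matrix (Fin 2) (Fin 2) ℂ)
    (A B : Matrix (Fin 2) (Fin 2) ℂ) :
    ∑ i : Fin (m + 2), (if i = 0 then A else if i = Fin.last (m + 1) then B else f i) =
      A + (∑ i ∈ Finset.range m, f (i + 1) + B) := by
  rw [sum_univ_middle, Finset.sum_range]
  simp only [middle_ne_zero, middle_ne_last, if_true, if_false]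
  rw [if_neg (by simp [Fin.ext_iff])]
  rfl

theorem isMasslessKinematics_bcfwLeft {m : ℕ} {q : Matrix (Fin 2) (Fin 2) ℂ}
    {k : Fin (m + 2) → Matrix (Fin 2) (Fin 2) ℂ} {p : ℕ} (hp : p < m)
    (hk : IsMasslessKinematics k) (hq : q.det = 0) (hq0 : twoDot q (k 0) = 0)
    (hqp : twoDot q (planarMomentum k p) ≠ 0) : IsMasslessKinematics (bcfwLeft q k p) := by
  refine ⟨fun i => ?_, ?_⟩
  · unfold bcfwLeft
    split_ifs
    · rw [det_add_smul, hk.1, hq0, hq]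
      ring
    · rw [Matrix.det_neg, det_bcfwInternal hq hqp, mul_zero]
    · exact hk.1 _
  · unfold bcfwLeft
    rw [sum_univ_middle_eq_of_ite fun i => k (Fin.ofNat (m + 2) i), bcfwInternal,
      planarMomentum_eq_sum_range k (by omega), Finset.sum_range_succ']
    simp only [Fin.ofNat_zero]
    abel

theorem isMasslessKinematics_bcfwRight {m : ℕ} {q : Matrix (Fin 2) (Fin 2) ℂ}
    {k : Fin (m + 2) → Matrix (Fin 2) (Fin 2) ℂ} {p : ℕ} (hp : p < m)
    (hk : IsMasslessKinematics k) (hq : q.det = 0)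
    (hqn : twoDot q (k (Fin.last (m + 1))) = 0)
    (hqp : twoDot q (planarMomentum k p) ≠ 0) : IsMasslessKinematics (bcfwRight q k p) := by
  refine ⟨fun i => ?_, ?_⟩
  · unfold bcfwRight
    split_ifs
    · exact det_bcfwInternal hq hqp
    · rw [sub_eq_add_neg, ← neg_smul, det_add_smul, hk.1, hqn, hq]
      ring
    · exact hk.1 _
  · unfold bcfwRight
    have htot := planarMomentum_last k
    rw [hk.2, planarMomentum_eq_sum_range k (by omega), Finset.sum_range_succ,
      show m + 1 = p + 1 + (m - p) by omega, Finset.sum_range_add,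
      ← planarMomentum_eq_sum_range k (by omega), ← show m + 1 = p + 1 + (m - p) by omega] at htot
    have hlast : Fin.ofNat (m + 2) (m + 1) = Fin.last (m + 1) := by
      ext
      simp
    rw [sum_univ_middle_eq_of_ite fun i => k (Fin.ofNat (m + 2) (i + p)), bcfwInternal, ← htot,
      hlast, Finset.sum_congr rfl fun i _ => by rw [show i + 1 + p = p + 1 + i by omega]]
    abel

/-- For four particles one of the two three-point vertices of the only channel vanishes. -/
theorem spinorX_bcfw_eq_zero_or (η : Fin 2 → ℂ) {k₀ k₁ k₂ k₃ q : Matrix (Fin 2) (Fin 2) ℂ} {z : ℂ}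
    (h₀ : k₀.det = 0) (h₁ : k₁.det = 0) (h₂ : k₂.det = 0) (h₃ : k₃.det = 0) (hq : q.det = 0)
    (hsum : k₀ + k₁ + k₂ + k₃ = 0) (h₀₁ : (k₀ + k₁).det ≠ 0) (h₀₃ : (k₀ + k₃).det ≠ 0)
    (hq₀ : twoDot q k₀ = 0) (hq₃ : twoDot q k₃ = 0) (hq0 : q ≠ 0)
    (hz : (k₀ + k₁ + z • q).det = 0) :
    spinorX η (-(k₀ + k₁ + z • q)) k₁ = 0 ∨ spinorX η (k₃ - z • q) k₂ = 0 := by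
  have h₃₂ : k₃ + k₂ = -(k₀ + k₁) := by
    rw [eq_neg_iff_add_eq_zero, ← hsum]
    abel
  have h₂₃ : (k₃ + k₂).det ≠ 0 := by
    rw [h₃₂, Matrix.det_neg]
    simpa using h₀₁
  have hz' : (k₃ + k₂ + (-z) • q).det = 0 := by
    rw [h₃₂, neg_smul, ← neg_add, Matrix.det_neg, hz, mul_zero]
  rw [add_right_comm, spinorX_neg_add_self, neg_eq_zero, sub_eq_add_neg, ← neg_smul]
  obtain ⟨a, a', rfl⟩ := exists_eq_vecMulVec_of_det_eq_zero h₀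
  obtain ⟨d, d', rfl⟩ := exists_eq_vecMulVec_of_det_eq_zero h₃
  obtain ⟨x, x', rfl⟩ := exists_eq_vecMulVec_of_det_eq_zero hq
  rw [twoDot_vecMulVec] at hq₀ hq₃
  have hdet : (Matrix.vecMulVec a a' + Matrix.vecMulVec d d').det =
      spinorBracket a d * spinorBracket a' d' := by
    simp only [Matrix.det_fin_two, Matrix.add_apply, Matrix.vecMulVec_apply, spinorBracket]
    ring
  -- In two dimensions, two spinors parallel to the same nonzero spinor are parallel.
  have hcol : ∀ {y u v : Fin 2 → ℂ}, y ≠ 0 → spinorBracket y u = 0 → spinorBracket y v = 0 →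
      spinorBracket u v = 0 := by
    intro y u v hy hu hv
    by_contra huv
    apply hy
    have h : ∀ i, y i * spinorBracket u v = 0 := by
      simp only [spinorBracket] at hu hv ⊢
      refine Fin.forall_fin_two.mpr ⟨?_, ?_⟩
      · linear_combination u 0 * hv - v 0 * hu
      · linear_combination u 1 * hv - v 1 * hu
    exact funext fun i => (mul_eq_zero.mp (h i)).resolve_right huv
  -- If q shares its angle spinor with k₁ or kₙ, the vertex on that side vanishes. Otherwise its
  -- square spinor is parallel to both of theirs, which forces (k₁ + kₙ)² = 0.
  rcases mul_eq_zero.mp hq₀ with hxa | hxa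
  · exact Or.inl (spinorX_shift_eq_zero η h₁ hxa h₀₁ hz)
  rcases mul_eq_zero.mp hq₃ with hxd | hxd
  · exact Or.inr (spinorX_shift_eq_zero η h₂ hxd h₂₃ hz')
  refine absurd ?_ h₀₃
  rw [hdet, hcol (y := x') (fun h => hq0 (by rw [h, Matrix.vecMulVec_zero])) hxa hxd, mul_zero]

theorem xAmplitude_bcfw_eq_zero {η : Fin 2 → ℂ} {k : Fin (2 + 2) → Matrix (Fin 2) (Fin 2) ℂ}
    {q : Matrix (Fin 2) (Fin 2) ℂ} (hk : IsMasslessKinematics k) (hgen : IsGenericKinematics k)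
    (hq : q.det = 0) (hq0 : twoDot q (k 0) = 0) (hqn : twoDot q (k (Fin.last 3)) = 0)
    (hqp : twoDot q (planarMomentum k 1) ≠ 0) :
    xAmplitude η (bcfwLeft q k 1) = 0 ∨ xAmplitude η (bcfwRight q k 1) = 0 := by
  have hP : planarMomentum k 1 = k 0 + k 1 := by
    rw [planarMomentum_eq_sum_range k (by omega), Finset.sum_range_succ, Finset.sum_range_one]
    rfl
  have hsum : k 0 + k 1 + k 2 + k 3 = 0 := by rw [← hk.2, Fin.sum_univ_four]
  have h01 : (k 0 + k 1).det ≠ 0 := by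
    simpa [mandelstam] using hgen {0, 1} (by simp) (by simp)
  have h03 : (k 0 + k 3).det ≠ 0 := by
    simpa [mandelstam] using hgen {0, 3} (by simp) (by simp)
  have hz := det_bcfwInternal hq hqp
  rw [bcfwInternal, hP] at hz
  have hqne : q ≠ 0 := fun h => hqp (by rw [h, twoDot_eq]; simp)
  refine (spinorX_bcfw_eq_zero_or η (hk.1 0) (hk.1 1) (hk.1 2) (hk.1 3) hq hsum h01 h03 hq0 hqn
    hqne hz).imp (fun h => xAmplitude_three_eq_zero rfl ?_)
    fun h => xAmplitude_three_eq_zero rfl ?_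
  · rw [← hP] at h
    exact h
  · exact h

/-- With `n = m + 2 > 3` particles: the `X`-half-integrand vanishes on the support of the
scattering equations, the amplitude `𝒳_n` vanishes, and it satisfies the BCFW recursion
`𝒳_n = ∑_{j=2}^{n-2} 𝒳_{j+1} 𝒳_{n-j+1} / s_{1…j}` (`j = p + 1`) for the shifts
`k_1 + z q`, `k_n - z q`. -/
theorem mainTheorem8 (m : ℕ) (hm : 3 < m + 2) (η : Fin 2 → ℂ)
    (k : Fin (m + 2) → Matrix (Fin 2) (Fin 2) ℂ)
    (hk : IsMasslessKinematics k) (hgen : IsGenericKinematics k) :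
    (∀ σ : ScatteringSolution k, halfIntegrandX η k σ.1 = 0) ∧
    xAmplitude η k = 0 ∧
    ∀ q : Matrix (Fin 2) (Fin 2) ℂ,
      q.det = 0 → twoDot q (k 0) = 0 → twoDot q (k (Fin.last (m + 1))) = 0 →
      (∀ p ∈ Finset.Ico 1 m, twoDot q (planarMomentum k p) ≠ 0) →
      xAmplitude η k =
        ∑ p ∈ Finset.Ico 1 m,
          1 / (planarMomentum k p).det *
            xAmplitude η (bcfwLeft q k p) * xAmplitude η (bcfwRight q k p) := by
  have h0 : xAmplitude η k = 0 := xAmplitude_eq_zero (by omega) η hk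
  refine ⟨fun σ => ?_, h0, fun q hq hq0 hqn hqp => ?_⟩
  · obtain ⟨m, rfl⟩ := Nat.exists_eq_succ_of_ne_zero (by omega : m ≠ 0)
    refine (halfIntegrandX_eq_zero_or η hk σ).resolve_right fun h => ?_
    have hs := hgen {0, 1} (by rw [Finset.card_pair (by simp)])
      (by rw [Finset.card_pair (by simp)]; omega)
    rw [mandelstam, Finset.sum_pair (by simp)] at hs
    have h01 := h 0 1
    rw [twoDot, hk.1, hk.1, sub_zero, sub_zero] at h01
    exact hs h01
  · rw [h0, eq_comm]
    refine Finset.sum_eq_zero fun p hp => ?_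
    have hp' := Finset.mem_Ico.mp hp
    -- The factors have `p + 2` and `m - p + 2` particles; both have fewer than four only for `m =
    -- 2`, `p = 1`.
    by_cases h2 : 2 ≤ p
    · rw [xAmplitude_eq_zero h2 η (isMasslessKinematics_bcfwLeft hp'.2 hk hq hq0 (hqp p hp))]
      ring
    by_cases h3 : 2 ≤ m - p
    · rw [xAmplitude_eq_zero h3 η (isMasslessKinematics_bcfwRight hp'.2 hk hq hqn (hqp p hp))]
      ring
    obtain rfl : p = 1 := by omega
    obtain rfl : m = 2 := by omega
    rcases xAmplitude_bcfw_eq_zero (η := η) hk hgen hq hq0 hqn (hqp 1 hp) with h | h <;>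
      rw [h] <;> ring
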